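/- Let $N\ge 2$. For every $T>0$ let $H=H_T:[0,1]\to\mathbb{C}^{N\times N}$ be a three times differentiable family of Hermitian matrices, let $U(s,0)$, $s\in[0,1]$, be the solution of $\partial_s U(s,0)=-iT\,H(s)\,U(s,0)$, $U(0,0)=\mathbb 1$, and let $|G(s)\rangle$ be a normalized eigenvector of $H(s)$ whose eigenvalue $E_G(s)$ depends continuously on $s\in[0,1]$ and is non-degenerate for every $s\in[0,1]$. Let $\|\dot H\|,\|\ddot H\|,\|\dddot H\|$ be the suprema over $s\in[0,1]$ of the operator norms of the first three derivatives of $H$. Let $\gamma_{\min}$ be the infimum over $s\in[0,1]$ of $|E-E'|$ over all pairs of distinct eigenvalues $E,E'$ of $H(s)$, and let $\min_\nu\gamma_{\nu,G}(s)$ be the minimum of $|E-E_G(s)|$ over all eigenvalues $E\neq E_G(s)$ of $H(s)$. Assume that, as $T\to\infty$, $\|\ddot H\|\in o(\sqrt T)$ and $\|\dddot H\|\in o(T)$, and that $\|\dot H\|$ and $(\gamma_{\min})^{-1}$ are bounded above by constants that do not depend on $T>0$. Put $P_G(1)=|G(1)\rangle\langle G(1)|$ and $$B(T)=\max_{s=0,1}\left[\frac{\|\dot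 H(s)\|}{\min_\nu[\gamma_{\nu,G}(s)]^2\,T}\right].$$ If the leading-order coefficient $T\,B(T)$ does not degenerate, i.e. is bounded below by a positive constant for all sufficiently large $T$, then, as $T\to\infty$, $$\left\|(\mathbb 1-P_G(1))\,U(1,0)|G(0)\rangle\right\|\in O\left(\max_{s=0,1}\left[\frac{\|\dot H(s)\|}{\min_\nu[\gamma_{\nu,G}(s)]^2\,T}\right]\right).$$ Without this condition on $T\,B(T)$ there is a constant $C$ with $$\left\|(\mathbb 1-P_G(1))\,U(1,0)|G(0)\rangle\right\|\le C\,B(T)+o(1/T)\qquad(T\to\infty).$$ -/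

import Mathlib

open Set Filter Topology Asymptotics
open scoped ENNReal NNReal

noncomputable section

section HilbertSpace

variable {V : Type*} [NormedAddCommGroup V] [InnerProductSpace ℂ V]

/-- The set of energies (real eigenvalues) of an operator. -/
def energies (A : V →L[ℂ] V) : Set ℝ :=
  {E | Module.End.HasEigenvalue (A : V →ₗ[ℂ] V) (E : ℂ)}

/-- The `k`-th derivative of `H` on the interval `[0,1]` (one-sided at the end points). -/
def hamDeriv (k : ℕ) (H : ℝ → V →L[ℂ] V) : ℝ → V →L[ℂ] V :=
  iteratedDerivWithin k H (Icc 0 1)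

/-- `H` is differentiable three times on `[0,1]`; the third derivative need not be continuous. -/
def ThriceDifferentiable (H : ℝ → V →L[ℂ] V) : Prop :=
  ∀ k < 3, DifferentiableOn ℝ (hamDeriv k H) (Icc 0 1)

/-- `G` is an instantaneous non-degenerate (normalized) eigenstate of `H` on `[0,1]`, belonging to
the energy level `E`: the level varies continuously, and each `E s` is an eigenvalue of
multiplicity one of `H s`. -/
structure IsNondegenerateEigenstate (H : ℝ → V →L[ℂ] V) (E : ℝ → ℝ) (G : ℝ → V) : Prop where
  level_continuous : ContinuousOn E (Icc 0 1)
  norm_eq_one : ∀ s ∈ Icc (0 : ℝ) 1, ‖G s‖ = 1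
  eigen : ∀ s ∈ Icc (0 : ℝ) 1, H s (G s) = (E s : ℂ) • G s
  nondegenerate : ∀ s ∈ Icc (0 : ℝ) 1,
    Module.finrank ℂ (Module.End.eigenspace (H s : V →ₗ[ℂ] V) (E s : ℂ)) = 1

/-- The minimum over `s ∈ [0,1]` of the gaps between any two distinct eigenvalues of `H s`
(an infimum in `[0,∞]`, so that its inverse is `∞` if gaps get arbitrarily small). -/
def gapMin (H : ℝ → V →L[ℂ] V) : ℝ≥0∞ :=
  ⨅ s ∈ Icc (0 : ℝ) 1, ⨅ E ∈ energies (H s), ⨅ E' ∈ energies (H s), ⨅ _ : E ≠ E',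
    ENNReal.ofReal |E - E'|

/-- The minimum gap between the eigenvalue `E` of `A` and the other eigenvalues of `A`
(for a Hermitian matrix, the minimum of a finite set, non-empty unless `A = E • 1`). -/
def levelGap (A : V →L[ℂ] V) (E : ℝ) : ℝ :=
  sInf {g | ∃ E' ∈ energies A, E' ≠ E ∧ g = |E' - E|}

/-- `U s` is the time-evolution operator `U(s,0)` generated by `H` in the dimensionless time
`s = t / T`: the solution on `[0,1]` of `dU/ds = -i T H(s) U(s)`, `U(0) = 1`. -/
structure IsTimeEvolution (T : ℝ) (H : ℝ → V →L[ℂ] V) (U : ℝ → V →L[ℂ] V) : Prop where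
  initial : U 0 = 1
  schrodinger : ∀ s ∈ Icc (0 : ℝ) 1,
    HasDerivWithinAt U ((-(Complex.I * (T : ℂ))) • (H s * U s)) (Icc 0 1) s

/-- The error `‖(1 - |G(1)⟩⟨G(1)|) U(1,0) |G(0)⟩‖` of the adiabatic approximation. -/
def adiabaticError (G : ℝ → V) (U : ℝ → V →L[ℂ] V) : ℝ :=
  ‖((1 : V →L[ℂ] V) - InnerProductSpace.rankOne ℂ (G 1) (G 1)) (U 1 (G 0))‖

/-- The quantity `max_{s = 0, 1} ‖H'(s)‖ / (min_ν γ_{ν,G}(s)² T)`. -/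
def standardEstimate (T : ℝ) (H : ℝ → V →L[ℂ] V) (E : ℝ → ℝ) : ℝ :=
  max (‖hamDeriv 1 H 0‖ / (levelGap (H 0) (E 0) ^ 2 * T))
    (‖hamDeriv 1 H 1‖ / (levelGap (H 1) (E 1) ^ 2 * T))

/-- For a family `H T`, `T > 0`, of Hamiltonians on `[0,1]`: the derivative of order `k` satisfies
`sup_{s ∈ [0,1]} ‖(d/ds)^k H T s‖ ∈ o(g T)` as `T → ∞`. -/
def DerivNormIsLittleO (k : ℕ) (H : ℝ → ℝ → V →L[ℂ] V) (g : ℝ → ℝ) : Prop :=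
  ∀ ε > 0, ∀ᶠ T in atTop, ∀ s ∈ Icc (0 : ℝ) 1, ‖hamDeriv k (H T) s‖ ≤ ε * g T

/-- The norm of the derivative of order `k` is bounded, uniformly in `s ∈ [0,1]`, by a constant
that does not depend on `T > 0`. -/
def DerivNormBounded (k : ℕ) (H : ℝ → ℝ → V →L[ℂ] V) : Prop :=
  ∃ b : ℝ, ∀ T > 0, ∀ s ∈ Icc (0 : ℝ) 1, ‖hamDeriv k (H T) s‖ ≤ b

end HilbertSpace

/-- The state space `ℂᴺ` with its Euclidean norm. -/
abbrev StateSpace (N : ℕ) : Type := EuclideanSpace ℂ (Fin N)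

/-- Linear operators on `ℂᴺ`, that is, complex `N × N` matrices, normed by the operator norm. -/
abbrev Op (N : ℕ) : Type := StateSpace N →L[ℂ] StateSpace N

end

/-! The argument is a superadiabatic expansion. Let `P` be the projection onto the level, `R` the
reduced resolvent of `H - E` and `h = H'`. Since `G` need not depend continuously on `s`, everything
is expressed through `P`. One seeks `W = P + T⁻¹ D + T⁻² F` that nearly solves the Heisenberg
equation `W' + iT [H, W] = 0`. Comparing powers of `T` gives `[H, P] = 0`, `P' + i[H, D] = 0` and
`D' + i[H, F] = 0`. The last two are solved by `firstCorrection` and `secondCorrection`, and the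
residual is exactly `T⁻² F'` (`superadiabatic_residual`). By unitarity, `U* W U` moves by at most
the supremum of `T⁻² ‖F'‖` between `s = 0` and `s = 1`.

Replacing `P` by `W` in `(1 - P(1)) U P(0)` therefore leaves only end-point terms. The `T⁻¹` terms
are `R² h P` up to a phase, hence at most `‖h‖ / γ²` because `‖R‖ ≤ 1/γ`; the two end points give
the factor `2`. The remaining terms are `T⁻² F` and `T⁻² F'`.

First order perturbation theory writes `P'` and `R'` as polynomials in `P`, `R`, `h` and the scalar
`E'`. The corrections are then differentiable, and the growth conditions on `h'` and `h''` give `F,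
F' = o(T)`, so that the remainder is `o(1/T)`. A lower bound `a/T` on the leading term absorbs it.
-/

set_option linter.unusedSimpArgs false

/-- `P` is the spectral projection of `Z` for the eigenvalue `0` and `R` is the reduced
resolvent of `Z`. -/
structure IsReducedResolvent {A : Type*} [Ring A] (Z P R : A) : Prop where
  proj : P * P = P
  gen_mul_proj : Z * P = 0
  proj_mul_gen : P * Z = 0
  gen_mul_res : Z * R = 1 - P
  res_mul_gen : R * Z = 1 - P
  res_mul_proj : R * P = 0
  proj_mul_res : P * R = 0

/-! ### Perturbation theory of the projection and the reduced resolvent. -/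

namespace IsReducedResolvent

section Ring

variable {A : Type*} [Ring A] {Z P R Z₀ P₀ R₀ : A}

/-- As `Z P = 0`, the product `(Z - Z₀) P` is `-Z₀ P`, and `R₀ Z₀ = 1 - P₀`. -/
theorem compl_mul_proj (h : IsReducedResolvent Z P R) (h₀ : IsReducedResolvent Z₀ P₀ R₀) :
    (1 - P₀) * P = -(R₀ * (Z - Z₀) * P) := by
  rw [mul_assoc, sub_mul Z Z₀ P, h.gen_mul_proj, zero_sub, mul_neg, ← mul_assoc, h₀.res_mul_gen,
    neg_neg]

theorem proj_mul_compl (h : IsReducedResolvent Z P R) (h₀ : IsReducedResolvent Z₀ P₀ R₀) :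
    P₀ * (1 - P) = P₀ * (Z - Z₀) * R := by
  rw [mul_sub P₀ Z Z₀, h₀.proj_mul_gen, sub_zero, mul_assoc, h.gen_mul_res]

theorem proj_sub (h : IsReducedResolvent Z P R) (h₀ : IsReducedResolvent Z₀ P₀ R₀) :
    P - P₀ = -(R₀ * (Z - Z₀) * P) - P₀ * (Z - Z₀) * R := by
  rw [← h.compl_mul_proj h₀, ← h.proj_mul_compl h₀]
  noncomm_ring

/-- A second resolvent identity. Because `Z R` is `1 - P` and not `1`, the terms `R P₀` and `P R₀`
are left over; they too carry a factor `Z - Z₀`, as `Z₀ P₀ = 0` and `P Z = 0`. -/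
theorem res_sub (h : IsReducedResolvent Z P R) (h₀ : IsReducedResolvent Z₀ P₀ R₀) :
    R - R₀ = R * R * (Z - Z₀) * P₀ + P * (Z - Z₀) * R₀ * R₀ - R * (Z - Z₀) * R₀ := by
  have h1 : R * R * (Z - Z₀) * P₀ = R * P₀ := by
    rw [mul_sub, sub_mul, mul_assoc _ Z₀, h₀.gen_mul_proj, mul_assoc R R Z, h.res_mul_gen, mul_sub,
      h.res_mul_proj]
    simp
  have h2 : P * (Z - Z₀) * R₀ * R₀ = -(P * R₀) := by
    rw [mul_sub, h.proj_mul_gen, zero_sub, neg_mul, neg_mul, mul_assoc P Z₀ R₀, h₀.gen_mul_res,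
      mul_assoc, sub_mul, h₀.proj_mul_res]
    simp
  have h3 : R * (Z - Z₀) * R₀ = (1 - P) * R₀ - R * (1 - P₀) := by
    rw [mul_sub, sub_mul, h.res_mul_gen, mul_assoc, h₀.gen_mul_res]
  rw [h1, h2, h3]
  noncomm_ring

end Ring

section Deriv

variable {A : Type*} [NormedRing A] [NormedAlgebra ℝ A] {I : Set ℝ} {H P R : ℝ → A} {E : ℝ → ℝ}
  {h : A} {e s₀ K : ℝ} {τ : A →L[ℝ] ℝ}

/-- In `proj_sub` and `res_sub` every term has a factor `Z - Z₀`, which tends to zero, while the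
other factors stay bounded. -/
theorem continuousWithinAt (hres : ∀ s ∈ I, IsReducedResolvent (H s - E s • 1) (P s) (R s))
    (hP : ∀ s ∈ I, ‖P s‖ ≤ K) (hR : ∀ s ∈ I, ‖R s‖ ≤ K)
    (hE : ContinuousWithinAt E I s₀) (hH : ContinuousWithinAt H I s₀) (hs₀ : s₀ ∈ I) :
    ContinuousWithinAt P I s₀ ∧ ContinuousWithinAt R I s₀ := by
  have hZ : (fun s => (H s - E s • (1 : A)) - (H s₀ - E s₀ • (1 : A))) =o[𝓝[I] s₀]
      (fun _ => (1 : ℝ)) := by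
    rw [isLittleO_one_iff]
    have := (hH.sub (hE.smul continuousWithinAt_const (g := fun _ => (1 : A)))).sub_const
      (H s₀ - E s₀ • (1 : A))
    simpa [ContinuousWithinAt] using this
  have bdd {f : ℝ → A} (hf : ∀ s ∈ I, ‖f s‖ ≤ K) : f =O[𝓝[I] s₀] (fun _ => (1 : ℝ)) :=
    IsBigO.of_bound K (by
      filter_upwards [self_mem_nhdsWithin] with s hs
      simpa using hf s hs)
  have cst (a : A) : (fun _ => a) =O[𝓝[I] s₀] (fun _ : ℝ => (1 : ℝ)) :=
    isBigO_const_const _ one_ne_zero _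
  have concl {f : ℝ → A} (hf : (fun s => f s - f s₀) =o[𝓝[I] s₀] (fun _ => (1 : ℝ))) :
      ContinuousWithinAt f I s₀ := by
    rw [isLittleO_one_iff] at hf
    simpa [ContinuousWithinAt] using hf.add_const (f s₀)
  have mul1 {f g : ℝ → A} (hf : f =o[𝓝[I] s₀] (fun _ => (1 : ℝ)))
      (hg : g =O[𝓝[I] s₀] (fun _ => (1 : ℝ))) :
      (fun s => f s * g s) =o[𝓝[I] s₀] (fun _ => (1 : ℝ)) := by simpa using hf.mul_isBigO hg
  have mul2 {f g : ℝ → A} (hf : f =O[𝓝[I] s₀] (fun _ => (1 : ℝ)))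
      (hg : g =o[𝓝[I] s₀] (fun _ => (1 : ℝ))) :
      (fun s => f s * g s) =o[𝓝[I] s₀] (fun _ => (1 : ℝ)) := by simpa using hf.mul_isLittleO hg
  have mem : ∀ᶠ s in 𝓝[I] s₀, s ∈ I := self_mem_nhdsWithin
  constructor
  · apply concl
    have := (mul1 (mul2 (cst (R s₀)) hZ) (bdd hP)).neg_left.sub
      (mul1 (mul2 (cst (P s₀)) hZ) (bdd hR))
    refine this.congr' ?_ .rfl
    filter_upwards [mem] with s hs
    exact ((hres s hs).proj_sub (hres s₀ hs₀)).symm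
  · apply concl
    have hRR : (fun s => R s * R s) =O[𝓝[I] s₀] (fun _ => (1 : ℝ)) := by
      simpa using (bdd hR).mul (bdd hR)
    have := ((mul1 (mul2 hRR hZ) (cst (P s₀))).add
      (mul1 (mul1 (mul2 (bdd hP) hZ) (cst (R s₀))) (cst (R s₀)))).sub
      (mul1 (mul2 (bdd hR) hZ) (cst (R s₀)))
    refine this.congr' ?_ .rfl
    filter_upwards [mem] with s hs
    exact ((hres s hs).res_sub (hres s₀ hs₀)).symm

/-- First order perturbation theory for an isolated non-degenerate eigenvalue. -/
theorem hasDerivWithinAt (hres : ∀ s ∈ I, IsReducedResolvent (H s - E s • 1) (P s) (R s))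
    (hP : ∀ s ∈ I, ‖P s‖ ≤ K) (hR : ∀ s ∈ I, ‖R s‖ ≤ K)
    (hE : ContinuousWithinAt E I s₀) (hH : HasDerivWithinAt H h I s₀) (hs₀ : s₀ ∈ I)
    (hτ : τ (P s₀) = 1) (he : e = τ (P s₀ * h * P s₀)) :
    HasDerivWithinAt P (-(R s₀ * h * P s₀ + P s₀ * h * R s₀)) I s₀ ∧
    HasDerivWithinAt R (R s₀ * R s₀ * h * P s₀ + P s₀ * h * R s₀ * R s₀
      - R s₀ * (h - e • 1) * R s₀) I s₀ := by
  obtain ⟨cP, cR⟩ := continuousWithinAt hres hP hR hE hH.continuousWithinAt hs₀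
  set F := 𝓝[I \ {s₀}] s₀ with hF
  have hFI : F ≤ 𝓝[I] s₀ := nhdsWithin_mono _ sdiff_subset
  have tP : Tendsto P F (𝓝 (P s₀)) := cP.mono_left hFI
  have tR : Tendsto R F (𝓝 (R s₀)) := cR.mono_left hFI
  have tH := hasDerivWithinAt_iff_tendsto_slope.1 hH
  have mem : ∀ᶠ s in F, s ∈ I := hFI self_mem_nhdsWithin
  have c0 := hres s₀ hs₀
  have hP0 : P s₀ * P s₀ = P s₀ := c0.proj
  -- Only continuity of `E` is assumed. Its derivative comes from `P₀ (H - H₀) P = (E - E₀) P₀ P`: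
  -- apply `τ` and divide by `τ (P₀ P)`, which tends to `1`.
  have tE : Tendsto (slope E s₀) F (𝓝 e) := by
    have t1 : Tendsto (fun s => τ (P s₀ * P s)) F (𝓝 1) := by
      have := (τ.continuous.tendsto _).comp (tP.const_mul (P s₀))
      rwa [hP0, hτ] at this
    have t2 : Tendsto (fun s => τ (P s₀ * slope H s₀ s * P s)) F (𝓝 e) := by
      rw [he]
      exact (τ.continuous.tendsto _).comp ((tH.const_mul (P s₀)).mul tP)
    have t3 := t2.div t1 one_ne_zero
    rw [div_one] at t3
    refine t3.congr' ?_
    filter_upwards [mem, t1.eventually_ne one_ne_zero] with s hs hne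
    rw [Pi.div_apply, div_eq_iff hne]
    have key : P s₀ * (H s - H s₀) * P s = (E s - E s₀) • (P s₀ * P s) := by
      have a1 := (hres s hs).gen_mul_proj
      have a2 := c0.proj_mul_gen
      rw [sub_mul, smul_mul_assoc, one_mul, sub_eq_zero] at a1
      rw [mul_sub, mul_smul_comm, mul_one, sub_eq_zero] at a2
      rw [mul_sub, sub_mul, mul_assoc, a1, a2, sub_smul, mul_smul_comm, smul_mul_assoc]
    rw [slope_def_module, slope_def_module, mul_smul_comm, smul_mul_assoc, key, smul_smul,
      map_smul, smul_eq_mul, smul_eq_mul]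
  have tZ : Tendsto (fun s => slope H s₀ s - slope E s₀ s • (1 : A)) F (𝓝 (h - e • 1)) :=
    tH.sub (tE.smul_const 1)
  have slopeZ (s : ℝ) : slope H s₀ s - slope E s₀ s • (1 : A) =
      (s - s₀)⁻¹ • ((H s - E s • 1) - (H s₀ - E s₀ • 1)) := by
    rw [slope_def_module, slope_def_module, smul_assoc, ← smul_sub, sub_smul]
    congr 1
    abel
  constructor
  · rw [hasDerivWithinAt_iff_tendsto_slope]
    have := ((tZ.const_mul (R s₀)).mul tP).neg.sub ((tZ.const_mul (P s₀)).mul tR)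
    -- The scalar `e` drops out between `R` and `P`, since `R P = P R = 0`.
    have e1 : -(R s₀ * (h - e • 1) * P s₀) - P s₀ * (h - e • 1) * R s₀ =
        -(R s₀ * h * P s₀ + P s₀ * h * R s₀) := by
      simp only [mul_sub, sub_mul, mul_smul_comm, smul_mul_assoc, mul_one, c0.res_mul_proj,
        c0.proj_mul_res]
      simp only [smul_zero, sub_zero]
      abel
    rw [e1] at this
    refine this.congr' ?_
    filter_upwards [mem] with s hs
    rw [slopeZ, slope_def_module, (hres s hs).proj_sub c0]
    generalize (H s - E s • 1) - (H s₀ - E s₀ • 1) = Δ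
    simp only [mul_smul_comm, smul_mul_assoc, smul_sub, smul_neg]
  · rw [hasDerivWithinAt_iff_tendsto_slope]
    have := ((((tR.mul tR).mul tZ).mul_const (P s₀)).add
      (((tP.mul tZ).mul_const (R s₀)).mul_const (R s₀))).sub
      ((tR.mul tZ).mul_const (R s₀))
    have e1 : R s₀ * R s₀ * (h - e • 1) * P s₀ + P s₀ * (h - e • 1) * R s₀ * R s₀ =
        R s₀ * R s₀ * h * P s₀ + P s₀ * h * R s₀ * R s₀ := by
      simp only [mul_sub, sub_mul, mul_smul_comm, smul_mul_assoc, mul_one, c0.proj_mul_res,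
        mul_assoc (R s₀) (R s₀) (P s₀), c0.res_mul_proj]
      simp only [mul_zero, zero_mul, smul_zero, sub_zero]
    rw [e1] at this
    refine this.congr' ?_
    filter_upwards [mem] with s hs
    rw [slopeZ, slope_def_module, (hres s hs).res_sub c0]
    generalize (H s - E s • 1) - (H s₀ - E s₀ • 1) = Δ
    simp only [mul_smul_comm, smul_mul_assoc, smul_sub, smul_add]

end Deriv

end IsReducedResolvent

/-! ### Calculus of orders of growth in `T`, uniform in `s`. -/

section Orders

variable {A : Type*} [NormedRing A]

/-- The filter of the limit `T → ∞`, uniformly in `s ∈ [0,1]`. -/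
def unifAtTop : Filter (ℝ × ℝ) := atTop ×ˢ 𝓟 (Icc 0 1)

/-- `f = O(1)`, uniformly on `[0,1]`. -/
def UnifBounded (f : ℝ → ℝ → A) : Prop :=
  (fun x : ℝ × ℝ => f x.1 x.2) =O[unifAtTop] (fun _ => (1 : ℝ))

/-- `f = o(√T)`, uniformly on `[0,1]`. -/
def UnifSqrt (f : ℝ → ℝ → A) : Prop :=
  (fun x : ℝ × ℝ => f x.1 x.2) =o[unifAtTop] (fun x => √x.1)

/-- `f = o(T)`, uniformly on `[0,1]`. -/
def UnifLin (f : ℝ → ℝ → A) : Prop :=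
  (fun x : ℝ × ℝ => f x.1 x.2) =o[unifAtTop] (fun x => x.1)

variable {f g : ℝ → ℝ → A}

theorem tendsto_fst_unifAtTop : Tendsto (fun x : ℝ × ℝ => x.1) unifAtTop atTop := tendsto_fst

theorem eventually_unifAtTop {p : ℝ → ℝ → Prop} :
    (∀ᶠ x in unifAtTop, p x.1 x.2) ↔ ∀ᶠ T in atTop, ∀ s ∈ Icc (0 : ℝ) 1, p T s :=
  eventually_prod_principal_iff

theorem one_isLittleO_sqrt : (fun _ => (1 : ℝ)) =o[unifAtTop] (fun x : ℝ × ℝ => √x.1) := by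
  rw [isLittleO_one_left_iff]
  refine Tendsto.congr (fun x => ?_) (Real.tendsto_sqrt_atTop.comp tendsto_fst_unifAtTop)
  simp [abs_of_nonneg (Real.sqrt_nonneg _)]

theorem sqrt_mul_sqrt_isBigO :
    (fun x : ℝ × ℝ => √x.1 * √x.1) =O[unifAtTop] (fun x : ℝ × ℝ => x.1) := by
  refine EventuallyEq.isBigO ?_
  filter_upwards [tendsto_fst_unifAtTop.eventually_ge_atTop 0] with x hx
  exact Real.mul_self_sqrt hx

theorem sqrt_isBigO_lin : (fun x : ℝ × ℝ => √x.1) =O[unifAtTop] (fun x : ℝ × ℝ => x.1) := by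
  simpa using (one_isLittleO_sqrt.isBigO.mul (isBigO_refl _ _)).trans sqrt_mul_sqrt_isBigO

namespace UnifBounded

theorem mul (hf : UnifBounded f) (hg : UnifBounded g) : UnifBounded (f * g) := by
  have := IsBigO.mul hf hg
  simp only [one_mul, mul_one] at this
  exact this

theorem sqrt (hf : UnifBounded f) : UnifSqrt f := hf.trans_isLittleO one_isLittleO_sqrt

theorem mul_sqrt (hf : UnifBounded f) (hg : UnifSqrt g) : UnifSqrt (f * g) := by
  have := IsBigO.mul_isLittleO hf hg
  simp only [one_mul, mul_one] at this
  exact this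

theorem mul_lin (hf : UnifBounded f) (hg : UnifLin g) : UnifLin (f * g) := by
  have := IsBigO.mul_isLittleO hf hg
  simp only [one_mul, mul_one] at this
  exact this

end UnifBounded

namespace UnifSqrt

theorem mul_bounded (hf : UnifSqrt f) (hg : UnifBounded g) : UnifSqrt (f * g) := by
  have := IsLittleO.mul_isBigO hf hg
  simp only [one_mul, mul_one] at this
  exact this

theorem lin (hf : UnifSqrt f) : UnifLin f := hf.trans_isBigO sqrt_isBigO_lin

/-- The scale `√T` is matched to `T` by this rule: a product of two first derivatives has the order
allowed for one second derivative. -/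
theorem mul (hf : UnifSqrt f) (hg : UnifSqrt g) : UnifLin (f * g) :=
  (IsLittleO.mul hf hg).trans_isBigO sqrt_mul_sqrt_isBigO

end UnifSqrt

theorem UnifLin.mul_bounded (hf : UnifLin f) (hg : UnifBounded g) : UnifLin (f * g) := by
  have := IsLittleO.mul_isBigO hf hg
  simp only [one_mul, mul_one] at this
  exact this

variable [NormedAlgebra ℂ A]

/-- `f' T` is the derivative of `f T` on `[0,1]` for every `T > 0`. -/
def HasDerivOnUnit (f f' : ℝ → ℝ → A) : Prop :=
  ∀ T > 0, ∀ s ∈ Icc (0 : ℝ) 1, HasDerivWithinAt (f T) (f' T s) (Icc 0 1) s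

/-- `f = O(1)` and `f' = o(√T)`. -/
def Slow (f : ℝ → ℝ → A) : Prop :=
  ∃ f', HasDerivOnUnit f f' ∧ UnifBounded f ∧ UnifSqrt f'

/-- `f = o(√T)` and `f' = o(T)`. -/
def Mild (f : ℝ → ℝ → A) : Prop :=
  ∃ f', HasDerivOnUnit f f' ∧ UnifSqrt f ∧ UnifLin f'

/-- `f = O(1)`, `f' = o(√T)` and `f'' = o(T)`. -/
def Slow₂ (f : ℝ → ℝ → A) : Prop :=
  ∃ f', HasDerivOnUnit f f' ∧ UnifBounded f ∧ Mild f'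

namespace HasDerivOnUnit

variable {f' g' : ℝ → ℝ → A}

theorem mul (hf : HasDerivOnUnit f f') (hg : HasDerivOnUnit g g') :
    HasDerivOnUnit (f * g) (f' * g + f * g') :=
  fun T hT s hs => (hf T hT s hs).mul (hg T hT s hs)

theorem add (hf : HasDerivOnUnit f f') (hg : HasDerivOnUnit g g') :
    HasDerivOnUnit (f + g) (f' + g') :=
  fun T hT s hs => (hf T hT s hs).add (hg T hT s hs)

theorem neg (hf : HasDerivOnUnit f f') : HasDerivOnUnit (-f) (-f') :=
  fun T hT s hs => (hf T hT s hs).neg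

theorem const_smul (c : ℂ) (hf : HasDerivOnUnit f f') : HasDerivOnUnit (c • f) (c • f') :=
  fun T hT s hs => (hf T hT s hs).const_smul c

end HasDerivOnUnit

namespace Slow

theorem mul (hf : Slow f) (hg : Slow g) : Slow (f * g) := by
  obtain ⟨f', df, bf, lf⟩ := hf
  obtain ⟨g', dg, bg, lg⟩ := hg
  exact ⟨_, df.mul dg, bf.mul bg, IsLittleO.add (lf.mul_bounded bg) (bf.mul_sqrt lg)⟩

theorem add (hf : Slow f) (hg : Slow g) : Slow (f + g) := by
  obtain ⟨f', df, bf, lf⟩ := hf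
  obtain ⟨g', dg, bg, lg⟩ := hg
  exact ⟨_, df.add dg, IsBigO.add bf bg, IsLittleO.add lf lg⟩

theorem neg (hf : Slow f) : Slow (-f) := by
  obtain ⟨f', df, bf, lf⟩ := hf
  exact ⟨_, df.neg, IsBigO.neg_left bf, IsLittleO.neg_left lf⟩

theorem sub (hf : Slow f) (hg : Slow g) : Slow (f - g) := by
  rw [sub_eq_add_neg]
  exact hf.add hg.neg

theorem map (L : A →L[ℝ] A) (hf : Slow f) : Slow (fun T s => L (f T s)) := by
  obtain ⟨f', df, bf, lf⟩ := hf
  exact ⟨fun T s => L (f' T s),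
    fun T hT s hs => L.hasFDerivAt.comp_hasDerivWithinAt s (df T hT s hs),
    (L.isBigO_comp _ _).trans bf, (L.isBigO_comp _ _).trans_isLittleO lf⟩

theorem bounded (hf : Slow f) : UnifBounded f := by
  obtain ⟨f', -, bf, -⟩ := hf
  exact bf

theorem mild (hf : Slow f) : Mild f := by
  obtain ⟨f', df, bf, lf⟩ := hf
  exact ⟨f', df, bf.sqrt, lf.lin⟩

theorem mul_mild (hf : Slow f) (hg : Mild g) : Mild (f * g) := by
  obtain ⟨f', df, bf, lf⟩ := hf
  obtain ⟨g', dg, bg, lg⟩ := hg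
  exact ⟨_, df.mul dg, bf.mul_sqrt bg, IsLittleO.add (lf.mul bg) (bf.mul_lin lg)⟩

end Slow

namespace Mild

theorem add (hf : Mild f) (hg : Mild g) : Mild (f + g) := by
  obtain ⟨f', df, bf, lf⟩ := hf
  obtain ⟨g', dg, bg, lg⟩ := hg
  exact ⟨_, df.add dg, IsLittleO.add bf bg, IsLittleO.add lf lg⟩

theorem const_smul (c : ℂ) (hf : Mild f) : Mild (c • f) := by
  obtain ⟨f', df, bf, lf⟩ := hf
  exact ⟨_, df.const_smul c, IsLittleO.const_smul_left bf c, IsLittleO.const_smul_left lf c⟩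

theorem neg (hf : Mild f) : Mild (-f) := by
  obtain ⟨f', df, bf, lf⟩ := hf
  exact ⟨_, df.neg, IsLittleO.neg_left bf, IsLittleO.neg_left lf⟩

theorem sub (hf : Mild f) (hg : Mild g) : Mild (f - g) := by
  rw [sub_eq_add_neg]
  exact hf.add hg.neg

theorem mul_slow (hf : Mild f) (hg : Slow g) : Mild (f * g) := by
  obtain ⟨f', df, bf, lf⟩ := hf
  obtain ⟨g', dg, bg, lg⟩ := hg
  exact ⟨_, df.mul dg, bf.mul_bounded bg, IsLittleO.add (lf.mul_bounded bg) (bf.mul lg)⟩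

end Mild

namespace Slow₂

theorem slow (hf : Slow₂ f) : Slow f := by
  obtain ⟨f', df, bf, f'', df', lf, lf'⟩ := hf
  exact ⟨f', df, bf, lf⟩

/-- In the Leibniz rule for the second derivative, the cross terms `f' g'` are products of two
`o(√T)` factors. -/
theorem mul (hf : Slow₂ f) (hg : Slow₂ g) : Slow₂ (f * g) := by
  have hf' := hf.slow
  have hg' := hg.slow
  obtain ⟨f', df, bf, lf⟩ := hf
  obtain ⟨g', dg, bg, lg⟩ := hg
  exact ⟨_, df.mul dg, bf.mul bg, (lf.mul_slow hg').add (hf'.mul_mild lg)⟩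

theorem const_smul (c : ℂ) (hf : Slow₂ f) : Slow₂ (c • f) := by
  obtain ⟨f', df, bf, lf⟩ := hf
  exact ⟨_, df.const_smul c, IsBigO.const_smul_left bf c, lf.const_smul c⟩

theorem sub (hf : Slow₂ f) (hg : Slow₂ g) : Slow₂ (f - g) := by
  rw [sub_eq_add_neg]
  obtain ⟨f', df, bf, lf⟩ := hf
  obtain ⟨g', dg, bg, lg⟩ := hg
  exact ⟨_, df.add dg.neg, IsBigO.add bf (IsBigO.neg_left bg), lf.add lg.neg⟩

end Slow₂

end Orders

/-! ### Algebra of the superadiabatic corrections. -/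

section Corrections

variable {A : Type*} [Ring A] [Algebra ℂ A]

/-- The first order correction to the adiabatic invariant `P`, where `h` is the derivative of the
generator. -/
def firstCorrection (P R h : A) : A := -Complex.I • (R * R * h * P - P * h * R * R)

/-- The second order correction to the adiabatic invariant `P`, where `D'` is the derivative of the
first order correction. -/
def secondCorrection (P R h D' : A) : A :=
  Complex.I • (R * D' * P - P * D' * R) + R * R * h * P * h * R * R

namespace IsReducedResolvent

variable {Z P R : A}

omit [Algebra ℂ A] in
theorem mul_rules (c : IsReducedResolvent Z P R) :
    (∀ x, P * (P * x) = P * x) ∧ (∀ x, Z * (P * x) = 0) ∧ (∀ x, P * (Z * x) = 0) ∧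
    (∀ x, Z * (R * x) = x - P * x) ∧ (∀ x, R * (Z * x) = x - P * x) ∧
    (∀ x, R * (P * x) = 0) ∧ (∀ x, P * (R * x) = 0) := by
  simp only [← mul_assoc, c.proj, c.gen_mul_proj, c.proj_mul_gen, c.gen_mul_res, c.res_mul_gen,
    c.res_mul_proj, c.proj_mul_res, sub_mul, one_mul, zero_mul, implies_true, and_self]

/-- This is the equation `P' + i[Z, D] = 0`. Commuting with `Z` removes one factor `R` from each
off-diagonal block of `D`. -/
theorem commutator_firstCorrection (c : IsReducedResolvent Z P R) (h : A) :
    -(R * h * P + P * h * R) +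
      Complex.I • (Z * firstCorrection P R h - firstCorrection P R h * Z) = 0 := by
  obtain ⟨c1, c2, c3, c4, c5, c6, c7⟩ := c.mul_rules
  simp only [firstCorrection, smul_mul_assoc, mul_smul_comm, mul_sub, sub_mul, mul_assoc, c1, c2,
    c3, c4, c5, c6, c7, c.proj, c.gen_mul_proj, c.proj_mul_gen, c.gen_mul_res, c.res_mul_gen,
    c.res_mul_proj, c.proj_mul_res, smul_sub, smul_smul, mul_neg, neg_mul, smul_neg, neg_smul,
    Complex.I_mul_I,
    mul_zero, mul_one, smul_zero]
  module

/-- Differentiating this identity yields the constraint on `D'` that makes the second order equation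
solvable. -/
theorem firstCorrection_offDiag (c : IsReducedResolvent Z P R) (h : A) :
    P * firstCorrection P R h + firstCorrection P R h * P = firstCorrection P R h := by
  obtain ⟨c1, c2, c3, c4, c5, c6, c7⟩ := c.mul_rules
  simp only [firstCorrection, smul_mul_assoc, mul_smul_comm, mul_sub, sub_mul, mul_assoc, c1, c6,
    c7, c.proj, c.res_mul_proj, smul_sub, neg_smul, neg_mul, mul_neg,
    mul_zero, smul_zero]
  module

/-- The hypothesis is the derivative of `D = P D + D P`. It determines the diagonal blocks of `D'`:
the one on the range of `P` vanishes, and the one on the complement is cancelled by the term `R² h P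
h R²`. The off-diagonal blocks are inverted with `R`. -/
theorem commutator_secondCorrection (c : IsReducedResolvent Z P R) (h D' : A)
    (hD' : -(R * h * P + P * h * R) * firstCorrection P R h + P * D' +
      (D' * P + firstCorrection P R h * -(R * h * P + P * h * R)) = D') :
    D' + Complex.I • (Z * secondCorrection P R h D' - secondCorrection P R h D' * Z) = 0 := by
  obtain ⟨c1, c2, c3, c4, c5, c6, c7⟩ := c.mul_rules
  have e : -(R * h * P + P * h * R) * firstCorrection P R h +
      firstCorrection P R h * -(R * h * P + P * h * R) =
      Complex.I • (R * R * h * P * h * R - R * h * P * h * R * R) := by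
    simp only [firstCorrection, smul_mul_assoc, mul_smul_comm, mul_sub, sub_mul, mul_add, add_mul,
      mul_assoc, c1, c6, c7, c.proj, c.res_mul_proj, smul_sub, smul_add, neg_smul, mul_zero,
      neg_mul, mul_neg]
    module
  have hsum : D' = P * D' + D' * P +
      Complex.I • (R * R * h * P * h * R - R * h * P * h * R * R) := by
    rw [← e]
    nth_rw 1 [← hD']
    abel
  -- This is the solvability condition: `[Z, F]` never has a block on the range of `P`.
  have hPP : P * D' * P = 0 := by
    have := congr_arg (fun x => P * x * P) hsum
    simp only [smul_mul_assoc, mul_smul_comm, mul_sub, sub_mul, mul_add, add_mul,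
      mul_assoc, c1, c6, c7, c.proj, c.res_mul_proj, smul_sub, mul_zero, smul_zero] at this
    rw [mul_assoc]
    simpa using this
  simp only [mul_assoc] at hPP
  simp only [secondCorrection, smul_mul_assoc, mul_smul_comm, mul_sub, sub_mul, mul_add, add_mul,
    mul_assoc, c1, c2, c3, c4, c5, c6, c7, c.proj, c.gen_mul_proj, c.proj_mul_gen, c.gen_mul_res,
    c.res_mul_gen, c.res_mul_proj, c.proj_mul_res, smul_sub, smul_smul, mul_neg, neg_smul,
    smul_add, Complex.I_mul_I, mul_zero, mul_one, smul_zero, hPP]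
  nth_rw 1 [hsum]
  simp only [mul_assoc]
  module

/-- Only one off-diagonal block of `D` survives at an end point, so its norm is at most `‖R‖² ‖h‖
‖P‖`. -/
theorem compl_mul_firstCorrection (c : IsReducedResolvent Z P R) (h : A) :
    (1 - P) * firstCorrection P R h = -Complex.I • (R * R * h * P) := by
  obtain ⟨c1, c2, c3, c4, c5, c6, c7⟩ := c.mul_rules
  simp only [firstCorrection, mul_smul_comm, mul_sub, sub_mul, mul_assoc, c1, c7, one_mul,
    sub_zero, sub_self]

theorem firstCorrection_mul_proj (c : IsReducedResolvent Z P R) (h : A) :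
    firstCorrection P R h * P = -Complex.I • (R * R * h * P) := by
  simp only [firstCorrection, smul_mul_assoc, sub_mul, mul_assoc, c.proj, c.res_mul_proj, mul_zero,
    sub_zero]

end IsReducedResolvent

end Corrections

/-! ### Unitarity and the Heisenberg picture. -/

section Evolution

variable {A : Type*} [NormedRing A] [NormedAlgebra ℂ A] [StarRing A] [CStarRing A] [StarModule ℂ A]
  {T : ℝ} {H U : ℝ → A}

theorem star_mul_self_of_schrodinger (hH : ∀ s ∈ Icc (0 : ℝ) 1, IsSelfAdjoint (H s)) (hU0 : U 0 = 1)
    (hU : ∀ s ∈ Icc (0 : ℝ) 1,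
      HasDerivWithinAt U ((-(Complex.I * (T : ℂ))) • (H s * U s)) (Icc 0 1) s) :
    ∀ s ∈ Icc (0 : ℝ) 1, star (U s) * U s = 1 := by
  have hd : ∀ s ∈ Icc (0 : ℝ) 1, HasDerivWithinAt (fun s => star (U s) * U s) 0 (Icc 0 1) s := by
    intro s hs
    convert (hU s hs).star.mul (hU s hs) using 1
    · rfl
    simp only [star_smul, star_mul, (hH s hs).star_eq, smul_mul_assoc, mul_smul_comm, mul_assoc,
      ← add_smul]
    simp
  intro s hs
  have := (convex_Icc (0 : ℝ) 1).norm_image_sub_le_of_norm_hasDerivWithin_le hd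
    (C := 0) (by simp) (left_mem_Icc.2 zero_le_one) hs
  rw [zero_mul, norm_le_zero_iff, sub_eq_zero] at this
  simpa [hU0] using this

/-- The derivative of `U* W U` is `U* (W' + iT [H, W]) U`, so the mean value inequality on an
interval of length `1` applies. -/
theorem norm_conj_sub_le_of_schrodinger {W W' : ℝ → A} {ε : ℝ}
    (hH : ∀ s ∈ Icc (0 : ℝ) 1, IsSelfAdjoint (H s)) (hU0 : U 0 = 1)
    (hU : ∀ s ∈ Icc (0 : ℝ) 1,
      HasDerivWithinAt U ((-(Complex.I * (T : ℂ))) • (H s * U s)) (Icc 0 1) s)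
    (hunit : ∀ s ∈ Icc (0 : ℝ) 1, ‖U s‖ ≤ 1)
    (hW : ∀ s ∈ Icc (0 : ℝ) 1, HasDerivWithinAt W (W' s) (Icc 0 1) s)
    (hε : ∀ s ∈ Icc (0 : ℝ) 1,
      ‖W' s + (Complex.I * (T : ℂ)) • (H s * W s - W s * H s)‖ ≤ ε) :
    ‖star (U 1) * W 1 * U 1 - W 0‖ ≤ ε := by
  have hd : ∀ s ∈ Icc (0 : ℝ) 1, HasDerivWithinAt (fun s => star (U s) * W s * U s)
      (star (U s) * (W' s + (Complex.I * (T : ℂ)) • (H s * W s - W s * H s)) * U s)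
      (Icc 0 1) s := by
    intro s hs
    convert ((hU s hs).star.mul (hW s hs)).mul (hU s hs) using 1
    · rfl
    simp only [star_smul, star_mul, (hH s hs).star_eq, Pi.mul_apply]
    simp only [mul_add, add_mul, mul_sub, sub_mul, smul_mul_assoc, mul_smul_comm, mul_assoc,
      smul_sub]
    simp
    module
  have := (convex_Icc (0 : ℝ) 1).norm_image_sub_le_of_norm_hasDerivWithin_le hd
    (C := ε) (fun s hs => ?_) (left_mem_Icc.2 zero_le_one) (right_mem_Icc.2 zero_le_one)
  · simpa [hU0] using this
  · have hε0 : 0 ≤ ε := (norm_nonneg _).trans (hε s hs)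
    have hstar : ‖star (U s)‖ ≤ 1 := by simpa using hunit s hs
    refine (norm_mul_le _ _).trans ?_
    refine (mul_le_mul (norm_mul_le _ _) (hunit s hs) (norm_nonneg _) (by positivity)).trans ?_
    rw [mul_one]
    refine (mul_le_mul hstar (hε s hs) (norm_nonneg _) zero_le_one).trans ?_
    rw [one_mul]

end Evolution

/-! ### Spectral gap and the norm of the reduced resolvent. -/

section HilbertSpaceLemmas

open InnerProductSpace

variable {V : Type*} [NormedAddCommGroup V] [InnerProductSpace ℂ V] [FiniteDimensional ℂ V]

/-- The real part of the trace as a bounded functional. -/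
noncomputable def reTrace : (V →L[ℂ] V) →L[ℝ] ℝ :=
  Complex.reCLM.comp ((LinearMap.toContinuousLinearMap
    ((LinearMap.trace ℂ V) ∘ₗ ContinuousLinearMap.coeLM ℂ)).restrictScalars ℝ)

theorem reTrace_rankOne {x : V} (hx : ‖x‖ = 1) : reTrace (rankOne ℂ x x) = 1 := by
  simp [reTrace, InnerProductSpace.trace_rankOne, hx]

/-- `Z + P` is injective, hence invertible in finite dimension, and `R = (Z + P)⁻¹ - P`. -/
theorem exists_isReducedResolvent {Z P : V →L[ℂ] V} (hP : P * P = P) (hZP : Z * P = 0)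
    (hPZ : P * Z = 0) (hker : ∀ v, Z v = 0 → P v = v) : ∃ R, IsReducedResolvent Z P R := by
  have hinj : Function.Injective ((Z + P : V →L[ℂ] V) : V →ₗ[ℂ] V) := by
    rw [← LinearMap.ker_eq_bot, LinearMap.ker_eq_bot']
    intro v hv
    replace hv : Z v + P v = 0 := hv
    have h1 : P v = 0 := by
      have h2 := congr_arg P hv
      rw [map_add, map_zero] at h2
      have h3 : P (Z v) = 0 := congr($hPZ v)
      have h4 : P (P v) = P v := congr($hP v)
      rwa [h3, h4, zero_add] at h2
    rw [h1, add_zero] at hv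
    rw [← hker v hv, h1]
  let e := LinearEquiv.ofInjectiveEndo _ hinj
  let B : V →L[ℂ] V := LinearMap.toContinuousLinearMap (e.symm : V →ₗ[ℂ] V)
  have h1 : (Z + P) * B = 1 := by
    ext v
    exact e.apply_symm_apply v
  have h2 : B * (Z + P) = 1 := by
    ext v
    exact e.symm_apply_apply v
  have h3 : B * P = P := by
    have : B * ((Z + P) * P) = P := by rw [← mul_assoc, h2, one_mul]
    rwa [add_mul, hZP, hP, zero_add] at this
  have h4 : P * B = P := by
    have : P * (Z + P) * B = P := by rw [mul_assoc, h1, mul_one]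
    rwa [mul_add, hPZ, hP, zero_add] at this
  refine ⟨B - P, hP, hZP, hPZ, ?_, ?_, ?_, ?_⟩
  · rw [mul_sub, hZP, sub_zero, ← h1, add_mul, h4, add_sub_cancel_right]
  · rw [sub_mul, hPZ, sub_zero, ← h2, mul_add, h3, add_sub_cancel_right]
  · rw [sub_mul, h3, hP, sub_self]
  · rw [mul_sub, h4, hP, sub_self]

omit [FiniteDimensional ℂ V] in
theorem eq_inner_smul_of_eigen {A : V →L[ℂ] V} {E : ℝ} {x v : V} (hx : ‖x‖ = 1)
    (hAx : A x = (E : ℂ) • x)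
    (hdim : Module.finrank ℂ (Module.End.eigenspace (A : V →ₗ[ℂ] V) (E : ℂ)) = 1)
    (hv : A v = (E : ℂ) • v) : v = inner ℂ x v • x := by
  have hx0 : x ≠ 0 := by
    rintro rfl
    simp at hx
  have hxm : x ∈ Module.End.eigenspace (A : V →ₗ[ℂ] V) (E : ℂ) :=
    Module.End.mem_eigenspace_iff.2 hAx
  have hvm : v ∈ Module.End.eigenspace (A : V →ₗ[ℂ] V) (E : ℂ) :=
    Module.End.mem_eigenspace_iff.2 hv
  obtain ⟨c, hc⟩ := (finrank_eq_one_iff_of_nonzero' (⟨x, hxm⟩ : Module.End.eigenspace _ _)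
    (by simpa using hx0)).1 hdim ⟨v, hvm⟩
  replace hc : c • x = v := congr_arg Subtype.val hc
  rw [← hc, inner_smul_right, inner_self_eq_norm_sq_to_K, hx]
  simp

/-- Expand in an orthonormal eigenbasis. A basis vector with eigenvalue `E` is parallel to `x`, so
its coefficient vanishes; every other coefficient is multiplied by at least `g` in modulus. -/
theorem mul_norm_le_of_gap {A : V →L[ℂ] V} (hA : IsSelfAdjoint A) {E g : ℝ} (hg : 0 ≤ g) {x v : V}
    (hx : ‖x‖ = 1) (hAx : A x = (E : ℂ) • x)
    (hdim : Module.finrank ℂ (Module.End.eigenspace (A : V →ₗ[ℂ] V) (E : ℂ)) = 1)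
    (hgap : ∀ E' ∈ energies A, E' ≠ E → g ≤ |E' - E|) (hxv : inner ℂ x v = 0) :
    g * ‖v‖ ≤ ‖A v - (E : ℂ) • v‖ := by
  have hs : (A : V →ₗ[ℂ] V).IsSymmetric := ContinuousLinearMap.isSelfAdjoint_iff_isSymmetric.1 hA
  let b := hs.eigenvectorBasis rfl
  let l := hs.eigenvalues rfl
  have hb (i) : A (b i) = (l i : ℂ) • b i := hs.apply_eigenvectorBasis rfl i
  have hl (i) : l i ∈ energies A := hs.hasEigenvalue_eigenvalues rfl i
  have hcoef (i) : inner ℂ (b i) (A v - (E : ℂ) • v) = ((l i - E : ℝ) : ℂ) * inner ℂ (b i) v := by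
    have h1 : inner ℂ (b i) (A v) = inner ℂ (A (b i)) v := (hs (b i) v).symm
    rw [inner_sub_right, h1, hb, inner_smul_left, inner_smul_right]
    simp [sub_mul]
  refine abs_le_of_sq_le_sq' ?_ (norm_nonneg _) |>.2
  rw [mul_pow, ← b.sum_sq_norm_inner_right v, ← b.sum_sq_norm_inner_right (A v - (E : ℂ) • v),
    Finset.mul_sum]
  refine Finset.sum_le_sum fun i _ => ?_
  rw [hcoef, norm_mul, Complex.norm_real, Real.norm_eq_abs, mul_pow]
  by_cases hi : l i = E
  · have h1 := eq_inner_smul_of_eigen hx hAx hdim (hi ▸ hb i)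
    rw [h1, inner_smul_left, hxv]
    simp
  · gcongr
    exact hgap _ (hl i) hi

theorem norm_compl_rankOne_le {x : V} (hx : ‖x‖ = 1) : ‖(1 : V →L[ℂ] V) - rankOne ℂ x x‖ ≤ 1 :=
  (isStarProjection_rankOne_self hx).one_sub.norm_le

/-- `R` maps into the orthogonal complement of `x`, where `A - E` is bounded below by `g`, and `(A -
E) R = 1 - P` is a contraction. -/
theorem norm_res_le_inv {A R : V →L[ℂ] V} (hA : IsSelfAdjoint A) {E g : ℝ} (hg : 0 < g) {x : V}
    (hx : ‖x‖ = 1) (hAx : A x = (E : ℂ) • x)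
    (hdim : Module.finrank ℂ (Module.End.eigenspace (A : V →ₗ[ℂ] V) (E : ℂ)) = 1)
    (hgap : ∀ E' ∈ energies A, E' ≠ E → g ≤ |E' - E|)
    (hR : IsReducedResolvent (A - E • (1 : V →L[ℂ] V)) (rankOne ℂ x x) R) : ‖R‖ ≤ g⁻¹ := by
  refine R.opNorm_le_bound (by positivity) fun w => ?_
  rw [inv_mul_eq_div, le_div_iff₀' hg]
  have h1 : inner ℂ x (R w) = 0 := by
    have h2 : inner ℂ x (R w) • x = 0 := congr($hR.proj_mul_res w)
    refine (smul_eq_zero.1 h2).resolve_right ?_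
    rintro rfl
    simp at hx
  refine (mul_norm_le_of_gap hA hg.le hx hAx hdim hgap h1).trans ?_
  have h2 : A (R w) - (E : ℂ) • R w = (1 - rankOne ℂ x x) w := by
    have h3 := congr($hR.gen_mul_res w)
    rw [← h3]
    rfl
  rw [h2]
  exact ((1 - rankOne ℂ x x).le_opNorm w).trans
    (mul_le_of_le_one_left (norm_nonneg _) (norm_compl_rankOne_le hx))

omit [FiniteDimensional ℂ V] in
theorem inv_le_abs_sub_of_gapMin {H : ℝ → V →L[ℂ] V} {c : ℝ≥0} (hc : 0 < c)
    (h : (gapMin H)⁻¹ ≤ (c : ℝ≥0∞)) {s : ℝ} (hs : s ∈ Icc (0 : ℝ) 1) {E E' : ℝ}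
    (hE : E ∈ energies (H s)) (hE' : E' ∈ energies (H s)) (hne : E' ≠ E) :
    (c : ℝ)⁻¹ ≤ |E' - E| := by
  have h1 : gapMin H ≤ ENNReal.ofReal |E' - E| :=
    (iInf₂_le s hs).trans <| (iInf₂_le E' hE').trans <| (iInf₂_le E hE).trans <| iInf_le _ hne
  have h2 : (c : ℝ≥0∞)⁻¹ ≤ ENNReal.ofReal |E' - E| := (ENNReal.inv_le_iff_inv_le.1 h).trans h1
  rw [← ENNReal.coe_inv hc.ne'] at h2
  have := (ENNReal.le_ofReal_iff_toReal_le ENNReal.coe_ne_top (abs_nonneg _)).1 h2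
  simpa using this

theorem norm_res_le_inv_levelGap {A R : V →L[ℂ] V} (hA : IsSelfAdjoint A) {E δ : ℝ} (hδ : 0 < δ)
    {x : V} (hx : ‖x‖ = 1) (hAx : A x = (E : ℂ) • x)
    (hdim : Module.finrank ℂ (Module.End.eigenspace (A : V →ₗ[ℂ] V) (E : ℂ)) = 1)
    (hgap : ∀ E' ∈ energies A, E' ≠ E → δ ≤ |E' - E|)
    (hR : IsReducedResolvent (A - E • (1 : V →L[ℂ] V)) (rankOne ℂ x x) R) :
    ‖R‖ ≤ (levelGap A E)⁻¹ := by
  by_cases hne : {g | ∃ E' ∈ energies A, E' ≠ E ∧ g = |E' - E|}.Nonempty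
  · have hpos : 0 < levelGap A E := by
      refine hδ.trans_le (le_csInf hne ?_)
      rintro _ ⟨E', hE', hE'E, rfl⟩
      exact hgap E' hE' hE'E
    refine norm_res_le_inv hA hpos hx hAx hdim (fun E' hE' hE'E => ?_) hR
    refine csInf_le ⟨0, ?_⟩ ⟨E', hE', hE'E, rfl⟩
    rintro _ ⟨E'', -, -, rfl⟩
    exact abs_nonneg _
  -- With no other eigenvalue the gap takes the default value `sInf ∅ = 0`, with inverse `0`. The
  -- bound still holds: every `g > 0` is then an admissible gap, which forces `‖R‖ ≤ 0`.
  · have h0 : levelGap A E = 0 := by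
      rw [levelGap, not_nonempty_iff_eq_empty.1 hne, Real.sInf_empty]
    rw [h0, inv_zero]
    refine ge_of_tendsto (tendsto_inv_atTop_zero (𝕜 := ℝ)) ?_
    filter_upwards [eventually_gt_atTop 0] with g hg
    refine norm_res_le_inv hA hg hx hAx hdim (fun E' hE' hE'E => ?_) hR
    exact (hne ⟨_, E', hE', hE'E, rfl⟩).elim

omit [FiniteDimensional ℂ V] in
theorem mem_energies {A : V →L[ℂ] V} {E : ℝ} {x : V} (hx : ‖x‖ = 1) (hAx : A x = (E : ℂ) • x) :
    E ∈ energies A := by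
  refine Module.End.hasEigenvalue_of_hasEigenvector (x := x)
    ⟨Module.End.mem_eigenspace_iff.2 hAx, ?_⟩
  rintro rfl
  simp at hx

theorem rankOne_eigen_relations {A : V →L[ℂ] V} (hA : IsSelfAdjoint A) {E : ℝ} {x : V}
    (hAx : A x = (E : ℂ) • x) :
    (A - E • (1 : V →L[ℂ] V)) * rankOne ℂ x x = 0 ∧
      rankOne ℂ x x * (A - E • (1 : V →L[ℂ] V)) = 0 := by
  constructor
  · ext v
    change A (inner ℂ x v • x) - (E : ℂ) • (inner ℂ x v • x) = 0
    rw [map_smul, hAx, smul_comm, sub_self]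
  · ext v
    change inner ℂ x (A v - (E : ℂ) • v) • x = 0
    have hs : (A : V →ₗ[ℂ] V).IsSymmetric := ContinuousLinearMap.isSelfAdjoint_iff_isSymmetric.1 hA
    have h1 : inner ℂ x (A v) = inner ℂ (A x) v := (hs x v).symm
    rw [inner_sub_right, h1, hAx, inner_smul_left, inner_smul_right]
    simp

end HilbertSpaceLemmas

/-! ### From the expansion to the transition amplitude. -/

section Estimate

/-- As `(1 - P₁) P₁ = 0`, the product `(1 - P₁) W₁` contains corrections only, and `W₀ P₀` differs
from `P₀` by corrections. The near invariance of `W` exchanges `u W₀` for `W₁ u`. -/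
theorem norm_compl_mul_evolution_mul_proj_le {A : Type*} [NormedRing A] [StarRing A] [CStarRing A]
    [NormedAlgebra ℂ A] {u P₀ P₁ D₀ D₁ F₀ F₁ : A} {t ε : ℝ} (ht : 0 ≤ t)
    (hu : u * star u = 1) (hu1 : ‖u‖ ≤ 1) (hP₀ : P₀ * P₀ = P₀) (hP₁ : P₁ * P₁ = P₁)
    (hP₀n : ‖P₀‖ ≤ 1) (hQ₁n : ‖1 - P₁‖ ≤ 1)
    (hW : ‖star u * (P₁ + t • D₁ + t ^ 2 • F₁) * u - (P₀ + t • D₀ + t ^ 2 • F₀)‖ ≤ ε) :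
    ‖(1 - P₁) * u * P₀‖ ≤
      t * (‖D₀ * P₀‖ + ‖(1 - P₁) * D₁‖) + t ^ 2 * (‖F₀‖ + ‖F₁‖) + ε := by
  set W₁ := P₁ + t • D₁ + t ^ 2 • F₁ with hW₁
  set W₀ := P₀ + t • D₀ + t ^ 2 • F₀ with hW₀
  have key : (1 - P₁) * u * P₀ =
      (t • ((1 - P₁) * D₁) + t ^ 2 • ((1 - P₁) * F₁)) * u * P₀
      - (1 - P₁) * u * (t • (D₀ * P₀) + t ^ 2 • (F₀ * P₀))
      - (1 - P₁) * u * (star u * W₁ * u - W₀) * P₀ := by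
    have e1 : t • ((1 - P₁) * D₁) + t ^ 2 • ((1 - P₁) * F₁) = (1 - P₁) * W₁ := by
      rw [hW₁, mul_add, mul_add, mul_smul_comm, mul_smul_comm, sub_mul 1 P₁ P₁, hP₁, one_mul,
        sub_self, zero_add]
    have e2 : t • (D₀ * P₀) + t ^ 2 • (F₀ * P₀) = W₀ * P₀ - P₀ := by
      rw [hW₀, add_mul, add_mul, smul_mul_assoc, smul_mul_assoc, hP₀]
      abel
    have e3 : (1 - P₁) * u * (star u * W₁ * u - W₀) * P₀ =
        (1 - P₁) * W₁ * u * P₀ - (1 - P₁) * u * W₀ * P₀ := by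
      have : (1 - P₁) * u * (star u * W₁ * u) = (1 - P₁) * (u * star u) * W₁ * u := by
        simp only [mul_assoc]
      rw [mul_sub, sub_mul, this, hu, mul_one]
    rw [e1, e2, e3]
    noncomm_ring
  have hQu : ‖(1 - P₁) * u‖ ≤ 1 :=
    (norm_mul_le _ _).trans (mul_le_one₀ hQ₁n (norm_nonneg _) hu1)
  have mr {x y : A} (hy : ‖y‖ ≤ 1) : ‖x * y‖ ≤ ‖x‖ :=
    (norm_mul_le _ _).trans (mul_le_of_le_one_right (norm_nonneg _) hy)
  have ml {x y : A} (hx : ‖x‖ ≤ 1) : ‖x * y‖ ≤ ‖y‖ :=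
    (norm_mul_le _ _).trans (mul_le_of_le_one_left (norm_nonneg _) hx)
  have ns {s : ℝ} (hs : 0 ≤ s) (x : A) : ‖s • x‖ = s * ‖x‖ := by
    rw [norm_smul, Real.norm_of_nonneg hs]
  have b1 : ‖(t • ((1 - P₁) * D₁) + t ^ 2 • ((1 - P₁) * F₁)) * u * P₀‖ ≤
      t * ‖(1 - P₁) * D₁‖ + t ^ 2 * ‖F₁‖ := by
    refine ((mr hP₀n).trans (mr hu1)).trans ((norm_add_le _ _).trans ?_)
    rw [ns ht, ns (sq_nonneg t)]
    gcongr
    exact ml hQ₁n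
  have b2 : ‖(1 - P₁) * u * (t • (D₀ * P₀) + t ^ 2 • (F₀ * P₀))‖ ≤
      t * ‖D₀ * P₀‖ + t ^ 2 * ‖F₀‖ := by
    refine (ml hQu).trans ((norm_add_le _ _).trans ?_)
    rw [ns ht, ns (sq_nonneg t)]
    gcongr
    exact mr hP₀n
  have b3 : ‖(1 - P₁) * u * (star u * W₁ * u - W₀) * P₀‖ ≤ ε :=
    ((mr hP₀n).trans (ml hQu)).trans hW
  rw [key]
  refine (norm_sub_le _ _).trans (add_le_add (norm_sub_le _ _) b3 |>.trans ?_)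
  linarith

theorem mul_star_self_of_star_mul_self {V : Type*} [NormedAddCommGroup V] [InnerProductSpace ℂ V]
    [FiniteDimensional ℂ V] {u : V →L[ℂ] V} (hu : star u * u = 1) : u * star u = 1 := by
  have h1 (v : V) : star u (u v) = v := congr($hu v)
  have hinj : Function.Injective (u : V →ₗ[ℂ] V) := Function.LeftInverse.injective h1
  ext v
  obtain ⟨w, hw⟩ := LinearMap.injective_iff_surjective.1 hinj v
  change u w = v at hw
  change u (star u v) = v
  rw [← hw, h1]

/-- The prefactor `T` shifts each commutator by one power, so it cancels the derivative of the
preceding term; only the derivative of the last term remains. -/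
theorem superadiabatic_residual {A : Type*} [Ring A] [Algebra ℂ A] {H P R h D' F' : A} {e : ℂ}
    {T : ℝ} (hT : 0 < T) (c : IsReducedResolvent (H - e • 1) P R)
    (hD' : -(R * h * P + P * h * R) * firstCorrection P R h + P * D' +
      (D' * P + firstCorrection P R h * -(R * h * P + P * h * R)) = D') :
    (-(R * h * P + P * h * R) + (T : ℂ)⁻¹ • D' + ((T : ℂ)⁻¹) ^ 2 • F') +
      (Complex.I * (T : ℂ)) •
        (H * (P + (T : ℂ)⁻¹ • firstCorrection P R h +
          ((T : ℂ)⁻¹) ^ 2 • secondCorrection P R h D') -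
        (P + (T : ℂ)⁻¹ • firstCorrection P R h + ((T : ℂ)⁻¹) ^ 2 • secondCorrection P R h D') * H) =
      ((T : ℂ)⁻¹) ^ 2 • F' := by
  have hT' : (T : ℂ) ≠ 0 := by exact_mod_cast hT.ne'
  have h0 : H * P - P * H = 0 := by
    have := c.gen_mul_proj.trans c.proj_mul_gen.symm
    rw [sub_mul, mul_sub, smul_mul_assoc, mul_smul_comm, one_mul, mul_one] at this
    exact sub_eq_zero.2 (sub_left_injective this)
  have comm (x : A) : (H - e • 1) * x - x * (H - e • 1) = H * x - x * H := by
    rw [sub_mul, mul_sub, smul_mul_assoc, mul_smul_comm, one_mul, mul_one]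
    abel
  have h1 := c.commutator_firstCorrection h
  have h2 := c.commutator_secondCorrection h D' hD'
  rw [comm] at h1 h2
  set D := firstCorrection P R h
  set F := secondCorrection P R h D'
  have e1 : H * (P + (T : ℂ)⁻¹ • D + ((T : ℂ)⁻¹) ^ 2 • F) -
      (P + (T : ℂ)⁻¹ • D + ((T : ℂ)⁻¹) ^ 2 • F) * H =
      (T : ℂ)⁻¹ • (H * D - D * H) + ((T : ℂ)⁻¹) ^ 2 • (H * F - F * H) := by
    simp only [mul_add, add_mul, mul_smul_comm, smul_mul_assoc, smul_sub]
    rw [← sub_eq_zero, ← h0]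
    abel
  rw [e1, smul_add, smul_smul, smul_smul]
  have a1 : Complex.I * (T : ℂ) * (T : ℂ)⁻¹ = Complex.I := by field_simp
  have a2 : Complex.I * (T : ℂ) * ((T : ℂ)⁻¹) ^ 2 = (T : ℂ)⁻¹ * Complex.I := by field_simp
  rw [a1, a2, mul_smul, ← sub_eq_zero]
  have h3 := congr_arg ((T : ℂ)⁻¹ • ·) h2
  simp only [smul_add, smul_zero] at h3
  calc _ = (-(R * h * P + P * h * R) + Complex.I • (H * D - D * H)) +
        ((T : ℂ)⁻¹ • D' + (T : ℂ)⁻¹ • Complex.I • (H * F - F * H)) := by abel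
    _ = 0 := by rw [h1, h3, add_zero]

end Estimate

section Superadiabatic

variable {A : Type*} [NormedRing A] [NormedAlgebra ℂ A] [StarRing A] [CStarRing A] [StarModule ℂ A]

/-- The adiabatic estimate with explicit error terms at the end points. -/
theorem norm_compl_mul_evolution_mul_proj_le_of_corrections {T ε : ℝ} {E : ℝ → ℝ}
    {H U P R h D' F' : ℝ → A} (hT : 0 < T)
    (hH : ∀ s ∈ Icc (0 : ℝ) 1, IsSelfAdjoint (H s)) (hU0 : U 0 = 1)
    (hU : ∀ s ∈ Icc (0 : ℝ) 1,
      HasDerivWithinAt U ((-(Complex.I * (T : ℂ))) • (H s * U s)) (Icc 0 1) s)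
    (hUn : ∀ s ∈ Icc (0 : ℝ) 1, ‖U s‖ ≤ 1) (hU1 : U 1 * star (U 1) = 1)
    (hR : ∀ s ∈ Icc (0 : ℝ) 1, IsReducedResolvent (H s - E s • 1) (P s) (R s))
    (hP₀ : ‖P 0‖ ≤ 1) (hQ₁ : ‖1 - P 1‖ ≤ 1)
    (dP : ∀ s ∈ Icc (0 : ℝ) 1,
      HasDerivWithinAt P (-(R s * h s * P s + P s * h s * R s)) (Icc 0 1) s)
    (dD : ∀ s ∈ Icc (0 : ℝ) 1,
      HasDerivWithinAt (fun s => firstCorrection (P s) (R s) (h s)) (D' s) (Icc 0 1) s)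
    (dF : ∀ s ∈ Icc (0 : ℝ) 1,
      HasDerivWithinAt (fun s => secondCorrection (P s) (R s) (h s) (D' s)) (F' s) (Icc 0 1) s)
    (hD' : ∀ s ∈ Icc (0 : ℝ) 1,
      -(R s * h s * P s + P s * h s * R s) * firstCorrection (P s) (R s) (h s) + P s * D' s +
        (D' s * P s + firstCorrection (P s) (R s) (h s) *
          -(R s * h s * P s + P s * h s * R s)) = D' s)
    (hF' : ∀ s ∈ Icc (0 : ℝ) 1, T⁻¹ ^ 2 * ‖F' s‖ ≤ ε) :
    ‖(1 - P 1) * U 1 * P 0‖ ≤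
      T⁻¹ * (‖firstCorrection (P 0) (R 0) (h 0) * P 0‖ +
        ‖(1 - P 1) * firstCorrection (P 1) (R 1) (h 1)‖) +
      T⁻¹ ^ 2 * (‖secondCorrection (P 0) (R 0) (h 0) (D' 0)‖ +
        ‖secondCorrection (P 1) (R 1) (h 1) (D' 1)‖) + ε := by
  have h0 : (0 : ℝ) ∈ Icc (0 : ℝ) 1 := left_mem_Icc.2 zero_le_one
  have h1 : (1 : ℝ) ∈ Icc (0 : ℝ) 1 := right_mem_Icc.2 zero_le_one
  refine norm_compl_mul_evolution_mul_proj_le (inv_nonneg.2 hT.le) hU1 (hUn 1 h1) (hR 0 h0).proj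
    (hR 1 h1).proj hP₀ hQ₁ ?_
  have cast (x : A) : T⁻¹ • x = (T : ℂ)⁻¹ • x := by
    rw [← Complex.ofReal_inv]
    rfl
  have cast2 (x : A) : T⁻¹ ^ 2 • x = (T : ℂ)⁻¹ ^ 2 • x := by
    rw [← Complex.ofReal_inv, ← Complex.ofReal_pow]
    rfl
  simp only [cast, cast2]
  refine norm_conj_sub_le_of_schrodinger (T := T)
    (W := fun s => P s + (T : ℂ)⁻¹ • firstCorrection (P s) (R s) (h s) +
      (T : ℂ)⁻¹ ^ 2 • secondCorrection (P s) (R s) (h s) (D' s)) hH hU0 hU hUn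
    (fun s hs => ((dP s hs).add ((dD s hs).const_smul ((T : ℂ)⁻¹))).add
      ((dF s hs).const_smul ((T : ℂ)⁻¹ ^ 2))) fun s hs => ?_
  have hres : IsReducedResolvent (H s - (E s : ℂ) • (1 : A)) (P s) (R s) := hR s hs
  rw [superadiabatic_residual (F' := F' s) hT hres (hD' s hs), norm_smul, norm_pow, norm_inv,
    Complex.norm_real, Real.norm_of_nonneg hT.le]
  exact hF' s hs

end Superadiabatic

/-! ### Orders of the corrections and the asymptotic bound. -/

theorem ThriceDifferentiable.hasDerivOnUnit {V : Type*} [NormedAddCommGroup V]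
    [InnerProductSpace ℂ V] {H : ℝ → ℝ → V →L[ℂ] V} (hH : ∀ T > 0, ThriceDifferentiable (H T))
    {k : ℕ} (hk : k < 3) :
    HasDerivOnUnit (fun T => hamDeriv k (H T)) (fun T => hamDeriv (k + 1) (H T)) := by
  intro T hT s hs
  have h1 := (hH T hT k hk s hs).hasDerivWithinAt
  have h2 : hamDeriv (k + 1) (H T) = derivWithin (hamDeriv k (H T)) (Icc 0 1) :=
    iteratedDerivWithin_succ
  change HasDerivWithinAt _ (hamDeriv (k + 1) (H T) s) _ _
  rwa [h2]

theorem HasDerivOnUnit.unique {A : Type*} [NormedRing A] [NormedAlgebra ℂ A] {f g f' g' : ℝ → ℝ → A}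
    (hf : HasDerivOnUnit f f') (hg : HasDerivOnUnit g g')
    (h : ∀ T > 0, ∀ s ∈ Icc (0 : ℝ) 1, g T s = f T s) {T s : ℝ} (hT : 0 < T)
    (hs : s ∈ Icc (0 : ℝ) 1) : g' T s = f' T s :=
  (uniqueDiffOn_Icc zero_lt_one s hs).eq_deriv _ (hg T hT s hs)
    ((hf T hT s hs).congr (h T hT) (h T hT s hs))

/-- The derivatives of the corrections to the adiabatic invariant exist and are of small order. -/
theorem exists_deriv_corrections {A : Type*} [NormedRing A] [NormedAlgebra ℂ A]
    {Z P R h : ℝ → ℝ → A} (L : A →L[ℝ] A)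
    (hR : ∀ T s, T > 0 → s ∈ Icc (0 : ℝ) 1 → IsReducedResolvent (Z T s) (P T s) (R T s))
    (hPb : UnifBounded P) (hRb : UnifBounded R) (hh : Slow₂ h)
    (dP : HasDerivOnUnit P (-(R * h * P + P * h * R)))
    (dR : HasDerivOnUnit R (R * R * h * P + P * h * R * R -
      R * (h - fun T s => L ((P * h * P) T s)) * R)) :
    ∃ D' F' : ℝ → ℝ → A,
      HasDerivOnUnit (fun T s => firstCorrection (P T s) (R T s) (h T s)) D' ∧
      HasDerivOnUnit (fun T s => secondCorrection (P T s) (R T s) (h T s) (D' T s)) F' ∧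
      UnifLin (fun T s => secondCorrection (P T s) (R T s) (h T s) (D' T s)) ∧ UnifLin F' ∧
      ∀ T > 0, ∀ s ∈ Icc (0 : ℝ) 1,
        -(R T s * h T s * P T s + P T s * h T s * R T s) *
            firstCorrection (P T s) (R T s) (h T s) + P T s * D' T s +
          (D' T s * P T s + firstCorrection (P T s) (R T s) (h T s) *
            -(R T s * h T s * P T s + P T s * h T s * R T s)) = D' T s := by
  set e : ℝ → ℝ → A := fun T s => L ((P * h * P) T s) with hedef
  have hhb := hh.slow.bounded
  -- A bootstrap: the formulas for `P'` and `R'` first show that these are bounded, so `P`, then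
  -- `e`, then `R` are `Slow`. Fed back into the same formulas, this controls the second
  -- derivatives.
  have hPs : Slow P := ⟨_, dP, hPb, UnifBounded.sqrt (IsBigO.neg_left
    (IsBigO.add ((hRb.mul hhb).mul hPb) ((hPb.mul hhb).mul hRb)))⟩
  have hes : Slow e := ((hPs.mul hh.slow).mul hPs).map L
  have hRs : Slow R := ⟨_, dR, hRb, UnifBounded.sqrt (IsBigO.sub (IsBigO.add
    (((hRb.mul hRb).mul hhb).mul hPb) (((hPb.mul hhb).mul hRb).mul hRb))
    ((hRb.mul (hh.slow.sub hes).bounded).mul hRb))⟩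
  have hP₂ : Slow₂ P := ⟨_, dP, hPb,
    (((hRs.mul hh.slow).mul hPs).add ((hPs.mul hh.slow).mul hRs)).neg.mild⟩
  have hR₂ : Slow₂ R := ⟨_, dR, hRb,
    (((((hRs.mul hRs).mul hh.slow).mul hPs).add (((hPs.mul hh.slow).mul hRs).mul hRs)).sub
      ((hRs.mul (hh.slow.sub hes)).mul hRs)).mild⟩
  -- the corrections
  set D : ℝ → ℝ → A := fun T s => firstCorrection (P T s) (R T s) (h T s)
  have hD₂ : Slow₂ D :=
    ((((hR₂.mul hR₂).mul hh).mul hP₂).sub (((hP₂.mul hh).mul hR₂).mul hR₂)).const_smul (-Complex.I)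
  obtain ⟨D', dD, -, mD'⟩ := hD₂
  set F : ℝ → ℝ → A := fun T s => secondCorrection (P T s) (R T s) (h T s) (D' T s)
  have hFm : Mild F :=
    ((((hRs.mul_mild mD').mul_slow hPs).sub ((hPs.mul_mild mD').mul_slow hRs)).const_smul
      Complex.I).add
      ((((((hRs.mul hRs).mul hh.slow).mul hPs).mul hh.slow).mul hRs).mul hRs).mild
  obtain ⟨F', dF, lF, lF'⟩ := hFm
  exact ⟨D', F', dD, dF, lF.lin, lF', fun T hT s hs =>
    HasDerivOnUnit.unique dD ((dP.mul dD).add (dD.mul dP))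
      (fun T hT s hs => (hR T s hT hs).firstCorrection_offDiag _) hT hs⟩

theorem norm_square_res_mul_le {A : Type*} [NormedRing A] [NormedAlgebra ℂ A] {R h P : A} {g : ℝ}
    (hP : ‖P‖ ≤ 1) (hR : ‖R‖ ≤ g⁻¹) : ‖-Complex.I • (R * R * h * P)‖ ≤ ‖h‖ / g ^ 2 := by
  rw [norm_smul, norm_neg, Complex.norm_I, one_mul]
  have h1 : ‖R * R * h * P‖ ≤ ‖R‖ * ‖R‖ * ‖h‖ * ‖P‖ :=
    (norm_mul_le _ _).trans <| by gcongr; exact norm_mul₃_le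
  refine h1.trans ?_
  have hg : 0 ≤ g⁻¹ := (norm_nonneg _).trans hR
  calc ‖R‖ * ‖R‖ * ‖h‖ * ‖P‖ ≤ g⁻¹ * g⁻¹ * ‖h‖ * 1 := by gcongr
    _ = ‖h‖ / g ^ 2 := by rw [mul_one, div_eq_mul_inv, ← inv_pow, sq, mul_comm]

/-- The factor `2` counts the end points. The values of `F` at `0` and `1` and the residual `F'`
each contribute one third of `ε / T`. -/
theorem eventually_adiabaticError_le {N : ℕ}
    {H : ℝ → ℝ → Op N} {E : ℝ → ℝ → ℝ} {G : ℝ → ℝ → StateSpace N} {U : ℝ → ℝ → Op N}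
    (hsa : ∀ T > 0, ∀ s ∈ Icc (0 : ℝ) 1, IsSelfAdjoint (H T s))
    (hdiff : ∀ T > 0, ThriceDifferentiable (H T))
    (hG : ∀ T > 0, IsNondegenerateEigenstate (H T) (E T) (G T))
    (hU : ∀ T > 0, IsTimeEvolution T (H T) (U T))
    (hH1 : DerivNormBounded 1 H)
    (hgap : ∃ c : ℝ≥0, ∀ T > 0, (gapMin (H T))⁻¹ ≤ (c : ℝ≥0∞))
    (hH2 : DerivNormIsLittleO 2 H (fun T => √T))
    (hH3 : DerivNormIsLittleO 3 H (fun T => T)) {ε : ℝ} (hε : 0 < ε) :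
    ∀ᶠ T in atTop,
      adiabaticError (G T) (U T) ≤ 2 * standardEstimate T (H T) (E T) + ε * (1 / T) := by
  obtain ⟨c₀, hc₀⟩ := hgap
  -- The added `1` makes the bound positive, so that `c⁻¹` is a genuine lower bound for the gaps.
  set c : ℝ≥0 := c₀ + 1 with hc
  have hcpos : 0 < c := by positivity
  have hgapc : ∀ T > 0, (gapMin (H T))⁻¹ ≤ (c : ℝ≥0∞) := fun T hT =>
    (hc₀ T hT).trans (by exact_mod_cast le_self_add)
  set P : ℝ → ℝ → Op N := fun T s => InnerProductSpace.rankOne ℂ (G T s) (G T s) with hPdef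
  set h : ℝ → ℝ → Op N := fun T => hamDeriv 1 (H T) with hhdef
  have hsep : ∀ T > 0, ∀ s ∈ Icc (0 : ℝ) 1, ∀ E' ∈ energies (H T s), E' ≠ E T s →
      (c : ℝ)⁻¹ ≤ |E' - E T s| := fun T hT s hs E' hE' hne =>
    inv_le_abs_sub_of_gapMin hcpos (hgapc T hT) hs
      (mem_energies ((hG T hT).norm_eq_one s hs) ((hG T hT).eigen s hs)) hE' hne
  have hexR : ∀ T s, ∃ R, T > 0 → s ∈ Icc (0 : ℝ) 1 →
      IsReducedResolvent (H T s - E T s • (1 : Op N)) (P T s) R := by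
    intro T s
    by_cases hTs : T > 0 ∧ s ∈ Icc (0 : ℝ) 1
    · obtain ⟨hT, hs⟩ := hTs
      have h1 := (hG T hT).norm_eq_one s hs
      have h2 := (hG T hT).eigen s hs
      obtain ⟨h3, h4⟩ := rankOne_eigen_relations (hsa T hT s hs) h2
      obtain ⟨R, hR⟩ := exists_isReducedResolvent
        (InnerProductSpace.isIdempotentElem_rankOne_self (𝕜 := ℂ) h1) h3 h4 (fun v hv =>
          (eq_inner_smul_of_eigen h1 h2 ((hG T hT).nondegenerate s hs) (sub_eq_zero.1 hv)).symm)
      exact ⟨R, fun _ _ => hR⟩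
    · exact ⟨0, fun hT hs => (hTs ⟨hT, hs⟩).elim⟩
  choose R hR using hexR
  have hPn : ∀ T > 0, ∀ s ∈ Icc (0 : ℝ) 1, ‖P T s‖ ≤ 1 := fun T hT s hs => by
    rw [hPdef, InnerProductSpace.norm_rankOne, (hG T hT).norm_eq_one s hs, one_mul]
  have hQn : ∀ T > 0, ∀ s ∈ Icc (0 : ℝ) 1, ‖1 - P T s‖ ≤ 1 := fun T hT s hs =>
    norm_compl_rankOne_le ((hG T hT).norm_eq_one s hs)
  have hRn : ∀ T > 0, ∀ s ∈ Icc (0 : ℝ) 1, ‖R T s‖ ≤ c := fun T hT s hs => by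
    have := norm_res_le_inv (hsa T hT s hs) (inv_pos.2 (NNReal.coe_pos.2 hcpos))
      ((hG T hT).norm_eq_one s hs) ((hG T hT).eigen s hs) ((hG T hT).nondegenerate s hs)
      (hsep T hT s hs) (hR T s hT hs)
    rwa [inv_inv] at this
  have hRγ : ∀ T > 0, ∀ s ∈ Icc (0 : ℝ) 1, ‖R T s‖ ≤ (levelGap (H T s) (E T s))⁻¹ :=
    fun T hT s hs => norm_res_le_inv_levelGap (hsa T hT s hs) (inv_pos.2 (NNReal.coe_pos.2 hcpos))
      ((hG T hT).norm_eq_one s hs) ((hG T hT).eigen s hs) ((hG T hT).nondegenerate s hs)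
      (hsep T hT s hs) (hR T s hT hs)
  -- orders of magnitude of the derivatives
  have bdd {f : ℝ → ℝ → Op N} {b : ℝ} (hf : ∀ T > 0, ∀ s ∈ Icc (0 : ℝ) 1, ‖f T s‖ ≤ b) :
      UnifBounded f := by
    refine IsBigO.of_bound b ((eventually_unifAtTop
      (p := fun T s => ‖f T s‖ ≤ b * ‖(1 : ℝ)‖)).2 ?_)
    filter_upwards [eventually_gt_atTop 0] with T hT s hs
    simpa using hf T hT s hs
  have hPb : UnifBounded P := bdd hPn
  have hRb : UnifBounded R := bdd hRn
  have hhb : UnifBounded h := hH1.elim fun b hb => bdd hb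
  have lit {f : ℝ → ℝ → Op N} {m : ℝ → ℝ} (hm : ∀ᶠ T in atTop, 0 ≤ m T)
      (hf : ∀ ε > 0, ∀ᶠ T in atTop, ∀ s ∈ Icc (0 : ℝ) 1, ‖f T s‖ ≤ ε * m T) :
      (fun x : ℝ × ℝ => f x.1 x.2) =o[unifAtTop] (fun x => m x.1) := by
    refine isLittleO_iff.2 fun ε hε => (eventually_unifAtTop
      (p := fun T s => ‖f T s‖ ≤ ε * ‖m T‖)).2 ?_
    filter_upwards [hf ε hε, hm] with T hT hmT s hs
    rw [Real.norm_of_nonneg hmT]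
    exact hT s hs
  have hh : Slow₂ h := ⟨_, ThriceDifferentiable.hasDerivOnUnit hdiff (by norm_num), hhb, _,
    ThriceDifferentiable.hasDerivOnUnit hdiff (by norm_num),
    lit (.of_forall Real.sqrt_nonneg) hH2, lit (eventually_ge_atTop 0) hH3⟩
  have hH0 : ∀ T > 0, ∀ s ∈ Icc (0 : ℝ) 1, HasDerivWithinAt (H T) (h T s) (Icc 0 1) s := by
    intro T hT s hs
    have := ThriceDifferentiable.hasDerivOnUnit hdiff (k := 0) (by norm_num) T hT s hs
    have h2 : hamDeriv 0 (H T) = H T := iteratedDerivWithin_zero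
    simp only [h2] at this
    exact this
  -- first order perturbation theory
  set e : ℝ → ℝ → Op N := fun T s =>
    (reTrace : Op N →L[ℝ] ℝ).smulRight (1 : Op N) ((P * h * P) T s) with hedef
  have hpert : ∀ T > 0, ∀ s ∈ Icc (0 : ℝ) 1,
      HasDerivWithinAt (P T) ((-(R * h * P + P * h * R)) T s) (Icc 0 1) s ∧
      HasDerivWithinAt (R T) ((R * R * h * P + P * h * R * R - R * (h - e) * R) T s)
        (Icc 0 1) s := fun T hT s hs =>
    IsReducedResolvent.hasDerivWithinAt (K := max 1 c) (fun s hs => hR T s hT hs)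
      (fun s hs => (hPn T hT s hs).trans (le_max_left _ _))
      (fun s hs => (hRn T hT s hs).trans (le_max_right _ _))
      ((hG T hT).level_continuous s hs) (hH0 T hT s hs) hs
      (reTrace_rankOne ((hG T hT).norm_eq_one s hs)) rfl
  have dP : HasDerivOnUnit P (-(R * h * P + P * h * R)) := fun T hT s hs => (hpert T hT s hs).1
  have dR : HasDerivOnUnit R (R * R * h * P + P * h * R * R - R * (h - e) * R) :=
    fun T hT s hs => (hpert T hT s hs).2
  obtain ⟨D', F', dD, dF, lF, lF', hD'⟩ := exists_deriv_corrections
    ((reTrace : Op N →L[ℝ] ℝ).smulRight (1 : Op N)) hR hPb hRb hh dP dR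
  have ev {f : ℝ → ℝ → Op N} (hf : UnifLin f) :
      ∀ᶠ T in atTop, ∀ s ∈ Icc (0 : ℝ) 1, ‖f T s‖ ≤ (ε / 3) * ‖T‖ :=
    eventually_unifAtTop.1 (isLittleO_iff.1 hf (by positivity))
  filter_upwards [ev lF, ev lF', eventually_gt_atTop 0] with T hF hF' hT
  rw [Real.norm_of_nonneg hT.le] at hF hF'
  have h0 : (0 : ℝ) ∈ Icc (0 : ℝ) 1 := left_mem_Icc.2 zero_le_one
  have h1 : (1 : ℝ) ∈ Icc (0 : ℝ) 1 := right_mem_Icc.2 zero_le_one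
  have hUU := star_mul_self_of_schrodinger (hsa T hT) (hU T hT).initial (hU T hT).schrodinger
  have hUn : ∀ s ∈ Icc (0 : ℝ) 1, ‖U T s‖ ≤ 1 := by
    intro s hs
    have h2 := CStarRing.norm_star_mul_self (x := U T s)
    rw [hUU s hs] at h2
    have h3 : ‖(1 : Op N)‖ ≤ 1 := ContinuousLinearMap.norm_id_le
    nlinarith [norm_nonneg (U T s)]
  have hscale : ∀ x : ℝ, x ≤ ε / 3 * T → (T⁻¹) ^ 2 * x ≤ ε / 3 * (1 / T) := by
    intro x hx
    calc (T⁻¹) ^ 2 * x ≤ (T⁻¹) ^ 2 * (ε / 3 * T) := by gcongr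
      _ = ε / 3 * (1 / T) := by field_simp
  have hbound := norm_compl_mul_evolution_mul_proj_le_of_corrections (ε := ε / 3 * (1 / T)) hT
    (hsa T hT) (hU T hT).initial (hU T hT).schrodinger hUn
    (mul_star_self_of_star_mul_self (hUU 1 h1)) (fun s => hR T s hT) (hPn T hT 0 h0)
    (hQn T hT 1 h1) (dP T hT) (dD T hT) (dF T hT) (hD' T hT) (fun s hs => hscale _ (hF' s hs))
  have hD0 : ‖firstCorrection (P T 0) (R T 0) (h T 0) * P T 0‖ ≤
      ‖h T 0‖ / levelGap (H T 0) (E T 0) ^ 2 := by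
    rw [(hR T 0 hT h0).firstCorrection_mul_proj]
    exact norm_square_res_mul_le (hPn T hT 0 h0) (hRγ T hT 0 h0)
  have hD1 : ‖(1 - P T 1) * firstCorrection (P T 1) (R T 1) (h T 1)‖ ≤
      ‖h T 1‖ / levelGap (H T 1) (E T 1) ^ 2 := by
    rw [(hR T 1 hT h1).compl_mul_firstCorrection]
    exact norm_square_res_mul_le (hPn T hT 1 h1) (hRγ T hT 1 h1)
  have hB0 : T⁻¹ * ‖firstCorrection (P T 0) (R T 0) (h T 0) * P T 0‖ ≤
      standardEstimate T (H T) (E T) := by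
    refine le_trans ?_ (le_max_left _ _)
    rw [← div_div, div_eq_inv_mul _ T]
    gcongr
  have hB1 : T⁻¹ * ‖(1 - P T 1) * firstCorrection (P T 1) (R T 1) (h T 1)‖ ≤
      standardEstimate T (H T) (E T) := by
    refine le_trans ?_ (le_max_right _ _)
    rw [← div_div, div_eq_inv_mul _ T]
    gcongr
  have herr : adiabaticError (G T) (U T) ≤ ‖(1 - P T 1) * U T 1 * P T 0‖ := by
    have hP0 : P T 0 (G T 0) = G T 0 := by
      rw [hPdef, InnerProductSpace.rankOne_apply, inner_self_eq_norm_sq_to_K,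
        (hG T hT).norm_eq_one 0 h0]
      simp
    have h2 := ((1 - P T 1) * U T 1 * P T 0).le_opNorm (G T 0)
    rw [(hG T hT).norm_eq_one 0 h0, mul_one] at h2
    refine le_trans (le_of_eq ?_) h2
    change ‖(1 - P T 1) (U T 1 (G T 0))‖ = ‖(1 - P T 1) (U T 1 (P T 0 (G T 0)))‖
    rw [hP0]
  have hF0 := hscale _ (hF 0 h0)
  have hF1 := hscale _ (hF 1 h1)
  linarith

theorem standardEstimate_nonneg {V : Type*} [NormedAddCommGroup V] [InnerProductSpace ℂ V] {T : ℝ}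
    (hT : 0 ≤ T) (H : ℝ → V →L[ℂ] V) (E : ℝ → ℝ) : 0 ≤ standardEstimate T H E :=
  le_max_of_le_left (by positivity)

theorem corollary1 {N : ℕ}
    (H : ℝ → ℝ → Op N) (E : ℝ → ℝ → ℝ) (G : ℝ → ℝ → StateSpace N) (U : ℝ → ℝ → Op N)
    (hsa : ∀ T > 0, ∀ s ∈ Icc (0 : ℝ) 1, IsSelfAdjoint (H T s))
    (hdiff : ∀ T > 0, ThriceDifferentiable (H T))
    (hG : ∀ T > 0, IsNondegenerateEigenstate (H T) (E T) (G T))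
    (hU : ∀ T > 0, IsTimeEvolution T (H T) (U T))
    (hH1 : DerivNormBounded 1 H)
    (hgap : ∃ c : ℝ≥0, ∀ T > 0, (gapMin (H T))⁻¹ ≤ (c : ℝ≥0∞))
    (hH2 : DerivNormIsLittleO 2 H (fun T => √T))
    (hH3 : DerivNormIsLittleO 3 H (fun T => T)) :
    ((∃ a > 0, ∀ᶠ T in atTop, a / T ≤ standardEstimate T (H T) (E T)) →
      (fun T => adiabaticError (G T) (U T)) =O[atTop]
        (fun T => standardEstimate T (H T) (E T))) ∧
    (∃ (C : ℝ) (r : ℝ → ℝ), r =o[atTop] (fun T => 1 / T) ∧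
      ∀ᶠ T in atTop,
        adiabaticError (G T) (U T) ≤ C * standardEstimate T (H T) (E T) + r T) := by
  -- The positive part of the excess is one remainder that serves all `ε` at once.
  set r : ℝ → ℝ := fun T =>
    max 0 (adiabaticError (G T) (U T) - 2 * standardEstimate T (H T) (E T)) with hr
  have hro : r =o[atTop] (fun T => 1 / T) := by
    refine isLittleO_iff.2 fun ε hε => ?_
    filter_upwards [eventually_adiabaticError_le hsa hdiff hG hU hH1 hgap hH2 hH3 hε,
      eventually_gt_atTop 0] with T hT hT0
    have h0 : 0 ≤ 1 / T := by positivity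
    rw [Real.norm_of_nonneg h0, Real.norm_of_nonneg (le_max_left _ _)]
    exact max_le (by positivity) (by linarith)
  have hle (T : ℝ) :
      adiabaticError (G T) (U T) ≤ 2 * standardEstimate T (H T) (E T) + r T := by
    have := le_max_right 0 (adiabaticError (G T) (U T) - 2 * standardEstimate T (H T) (E T))
    linarith
  refine ⟨?_, 2, r, hro, .of_forall hle⟩
  rintro ⟨a, ha, hB⟩
  -- Eventually `r T ≤ 1 / T`, and the lower bound `a / T` turns this into `1 / a` times the
  -- estimate.
  refine IsBigO.of_bound (2 + 1 / a) ?_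
  filter_upwards [hB, isLittleO_iff.1 hro one_pos, eventually_gt_atTop 0] with T hBT hrT hT
  have h0 : 0 ≤ 1 / T := by positivity
  rw [one_mul, Real.norm_of_nonneg h0] at hrT
  have h1 : 1 / T ≤ 1 / a * standardEstimate T (H T) (E T) := by
    calc 1 / T = 1 / a * (a / T) := by field_simp
      _ ≤ _ := by gcongr
  have h2 : 0 ≤ adiabaticError (G T) (U T) := norm_nonneg _
  rw [Real.norm_of_nonneg (standardEstimate_nonneg hT.le _ _), Real.norm_of_nonneg h2]
  linarith [hle T, le_abs_self (r T), Real.norm_eq_abs (r T)]
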